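/- Let $A$ be a complete Boolean algebra. For a topological space $X$, let $RC(X)$ denote the Boolean algebra of all regular closed subsets of $X$ (the sets $F \subseteq X$ with $F = \mathrm{cl}(\mathrm{int}(F))$), ordered by inclusion, with $0 = \emptyset$, $1 = X$, $F \vee G = F \cup G$, $F \wedge G = \mathrm{cl}(\mathrm{int}(F \cap G))$ and $F^* = \mathrm{cl}(X \setminus F)$. Then the following are equivalent: (a) there is a metrizable topological space $X$ such that $A$ is isomorphic, as a Boolean algebra, to $RC(X)$; (b) $A$ has a $\sigma$-disjointed dense subset, i.e. there is a set $B \subseteq A$ such that $B = \bigcup_{n \in \mathbb{N}} B_n$, where for every $n$ and every two different elements $a, b$ of $B_n$ we have $a \wedge b = 0$, and such that for every $a \in A \setminus \{0\}$ there is $b \in B \setminus \{0\}$ with $b \leq a$. -/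

import Mathlib

universe u

/-- `RC X`: the regular closed subsets of a topological space `X`,
that is, the sets `F` with `F = cl (int F)`. -/
def RC (X : Type*) [TopologicalSpace X] : Type _ :=
  {F : Set X // F = closure (interior F)}

namespace RC

variable {X : Type*} [TopologicalSpace X]

theorem isClosed (F : RC X) : IsClosed F.1 := by
  rw [F.2]
  exact isClosed_closure

theorem closure_interior_regular (s : Set X) :
    closure (interior s) = closure (interior (closure (interior s))) :=
  (closure_interior_idem (s := s)).symm

theorem closure_open_regular {s : Set X} (hs : IsOpen s) :
    closure s = closure (interior (closure s)) := by
  have h := closure_interior_regular s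
  rwa [hs.interior_eq] at h

theorem union_regular (F G : RC X) :
    F.1 ∪ G.1 = closure (interior (F.1 ∪ G.1)) := by
  apply Set.Subset.antisymm
  · apply Set.union_subset
    · conv_lhs => rw [F.2]
      exact closure_mono (interior_mono Set.subset_union_left)
    · conv_lhs => rw [G.2]
      exact closure_mono (interior_mono Set.subset_union_right)
  · exact closure_minimal interior_subset (F.isClosed.union G.isClosed)

theorem interior_union_subset {s t : Set X} (hs : IsClosed s) :
    interior (s ∪ t) ⊆ s ∪ interior t := by
  intro p hp
  by_cases h : p ∈ s
  · exact Or.inl h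
  · refine Or.inr (mem_interior.2 ⟨interior (s ∪ t) ∩ sᶜ, ?_,
      isOpen_interior.inter hs.isOpen_compl, hp, h⟩)
    rintro q ⟨hq, hqs⟩
    exact (interior_subset hq).resolve_left hqs

/-- The order is inclusion; `F ⊔ G = F ∪ G`, `F ⊓ G = cl (int (F ∩ G))`,
`Fᶜ = cl (X \ F)`, `⊤ = X` and `⊥ = ∅`. -/
instance instBooleanAlgebra : BooleanAlgebra (RC X) where
  le F G := F.1 ⊆ G.1
  le_refl _ := Set.Subset.rfl
  le_trans _ _ _ h₁ h₂ := Set.Subset.trans h₁ h₂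
  le_antisymm _ _ h₁ h₂ := Subtype.ext (Set.Subset.antisymm h₁ h₂)
  sup F G := ⟨F.1 ∪ G.1, union_regular F G⟩
  le_sup_left _ _ := Set.subset_union_left
  le_sup_right _ _ := Set.subset_union_right
  sup_le _ _ _ h₁ h₂ := Set.union_subset h₁ h₂
  inf F G := ⟨closure (interior (F.1 ∩ G.1)), closure_interior_regular _⟩
  inf_le_left F _ :=
    closure_minimal (interior_subset.trans Set.inter_subset_left) F.isClosed
  inf_le_right _ G :=
    closure_minimal (interior_subset.trans Set.inter_subset_right) G.isClosed
  le_inf F G H h₁ h₂ := by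
    change F.1 ⊆ closure (interior (G.1 ∩ H.1))
    conv_lhs => rw [F.2]
    exact closure_mono (interior_mono (Set.subset_inter h₁ h₂))
  le_sup_inf F G H := by
    change closure (interior ((F.1 ∪ G.1) ∩ (F.1 ∪ H.1))) ⊆
      F.1 ∪ closure (interior (G.1 ∩ H.1))
    rw [← Set.union_inter_distrib_left]
    exact closure_minimal
      ((interior_union_subset F.isClosed).trans
        (Set.union_subset_union_right _ subset_closure))
      (F.isClosed.union isClosed_closure)
  top := ⟨Set.univ, by simp⟩
  bot := ⟨∅, by simp⟩
  le_top _ := Set.subset_univ _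
  bot_le _ := Set.empty_subset _
  compl F := ⟨closure F.1ᶜ, closure_open_regular F.isClosed.isOpen_compl⟩
  inf_compl_le_bot F := by
    change closure (interior (F.1 ∩ closure F.1ᶜ)) ⊆ ∅
    have h : interior (closure F.1ᶜ) = F.1ᶜ := by
      rw [closure_compl, interior_compl, ← F.2]
    rw [interior_inter, h]
    have h' : interior F.1 ∩ F.1ᶜ = ∅ := by
      ext p
      simp only [Set.mem_inter_iff, Set.mem_compl_iff, Set.mem_empty_iff_false, iff_false]
      exact fun hp => hp.2 (interior_subset hp.1)
    simp [h']
  top_le_sup_compl F := by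
    change Set.univ ⊆ F.1 ∪ closure F.1ᶜ
    intro p _
    by_cases h : p ∈ F.1
    · exact Or.inl h
    · exact Or.inr (subset_closure h)

end RC

/-- `B` is a countable union of sets, any two different elements of each of which
have meet zero. -/
def IsSigmaDisjointed {A : Type*} [BooleanAlgebra A] (B : Set A) : Prop :=
  ∃ C : ℕ → Set A, B = ⋃ n, C n ∧
    ∀ n, ∀ a ∈ C n, ∀ b ∈ C n, a ≠ b → a ⊓ b = ⊥

/-- Every nonzero element of the Boolean algebra lies above a nonzero element of `B`. -/
def IsDenseInBooleanAlgebra {A : Type*} [BooleanAlgebra A] (B : Set A) : Prop :=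
  ∀ a : A, a ≠ ⊥ → ∃ b ∈ B, b ≠ ⊥ ∧ b ≤ a

/-!
Both directions work with `σ`-disjoint families that are dense in the Boolean algebra.

In a metric space, take for each `n` a maximal disjoint family of regular closed sets of diameter
at most `1 / (n + 1)` (`exists_maximal_pairwiseDisjoint`). A regular closed set containing
`ball x r` contains a member of such a family as soon as `1 / (n + 1) < r / 2`: by maximality some
member meets the ball around `x` of radius `1 / (2 (n + 1))`, and being small it stays inside
`ball x r`. So the union of these families is dense in `RC X`
(`RC.exists_isSigmaDisjointed_isDense`).

Conversely, enlarge each disjoint set `C n` to a partition of unity `P n` by adding the complement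
of its supremum. The space is the set `Branch P` of sequences `x` with `x n ∈ P n` whose finite
meets `x 0 ⊓ ⋯ ⊓ x (n - 1)` are all nonzero, a subspace of a countable product of discrete spaces
and hence metrizable. As the `P n` are partitions, any nonzero element can be followed
downwards through all levels, and together with density this puts below every nonzero `c` some
finite meet of some branch (`Branch.exists_initialMeet_le`). Thus cylinders correspond to a
dense subset of `A`, and `a ↦ {x | every finite meet of x meets a}` is an order isomorphism of `A`
onto `RC (Branch P)` (`Branch.orderIso`); completeness is used for the suprema that give its
surjectivity.
-/

open Topology

/-! ### Metrizable spaces have a `σ`-disjointed dense family of regular closed sets -/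

/-- Every set `T` contains a maximal pairwise disjoint subset; by maximality each nonzero element
of `T` meets one of its members. -/
theorem exists_maximal_pairwiseDisjoint {A : Type*} [PartialOrder A] [OrderBot A] (T : Set A) :
    ∃ S ⊆ T, S.PairwiseDisjoint id ∧ ∀ t ∈ T, t ≠ ⊥ → ∃ s ∈ S, ¬ Disjoint s t := by
  obtain ⟨S, hS⟩ := zorn_subset {S : Set A | S ⊆ T ∧ S.PairwiseDisjoint id} (by
    intro c hc hchain
    refine ⟨⋃₀ c, ⟨Set.sUnion_subset fun s hs => (hc hs).1, ?_⟩,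
      fun s hs => Set.subset_sUnion_of_mem hs⟩
    exact (Set.pairwiseDisjoint_sUnion hchain.directedOn).2 fun s hs => (hc hs).2)
  refine ⟨S, hS.prop.1, hS.prop.2, fun t ht ht0 => ?_⟩
  by_contra! h
  have htS : t ∈ S := hS.mem_of_prop_insert
    ⟨Set.insert_subset ht hS.prop.1, hS.prop.2.insert fun s hs _ => (h s hs).symm⟩
  exact ht0 (disjoint_self.1 (h t htS))

namespace RC

theorem coe_nonempty_iff {X : Type*} [TopologicalSpace X] {F : RC X} : F.1.Nonempty ↔ F ≠ ⊥ := by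
  rw [Set.nonempty_iff_ne_empty, not_iff_not]
  exact ⟨fun h => Subtype.ext h, fun h => congrArg Subtype.val h⟩

theorem exists_isSigmaDisjointed_isDense {X : Type*} [TopologicalSpace X]
    [TopologicalSpace.MetrizableSpace X] :
    ∃ B : Set (RC X), IsSigmaDisjointed B ∧ IsDenseInBooleanAlgebra B := by
  let := TopologicalSpace.metrizableSpaceMetric X
  choose D hDT hD hmax using fun n : ℕ => exists_maximal_pairwiseDisjoint
    {F : RC X | ∀ p ∈ F.1, ∀ q ∈ F.1, dist p q ≤ 1 / ((n : ℝ) + 1)}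
  refine ⟨⋃ n, D n, ⟨D, rfl, fun n a ha b hb hab => (hD n ha hb hab).eq_bot⟩, fun F hF => ?_⟩
  obtain ⟨x, hx⟩ : (interior F.1).Nonempty := by
    rw [← closure_nonempty_iff, ← F.2]
    exact coe_nonempty_iff.2 hF
  obtain ⟨r, hr, hball⟩ := Metric.isOpen_iff.1 isOpen_interior x hx
  obtain ⟨n, hn⟩ := exists_nat_one_div_lt (half_pos hr)
  have hδ : 0 < 1 / ((n : ℝ) + 1) := by positivity
  set δ : ℝ := 1 / ((n : ℝ) + 1)
  let t : RC X := ⟨closure (Metric.ball x (δ / 2)), closure_open_regular Metric.isOpen_ball⟩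
  have hdist : ∀ p ∈ t.1, dist p x ≤ δ / 2 := fun p hp => Metric.closure_ball_subset_closedBall hp
  have ht : t ≠ ⊥ :=
    coe_nonempty_iff.1 ⟨x, subset_closure (Metric.mem_ball_self (half_pos hδ))⟩
  obtain ⟨s, hs, hst⟩ := hmax n t (fun p hp q hq => by
    linarith [dist_triangle_right p q x, hdist p hp, hdist q hq]) ht
  obtain ⟨p, hp⟩ := coe_nonempty_iff.2 (mt disjoint_iff.2 hst)
  have hps : p ∈ s.1 := (inf_le_left : s ⊓ t ≤ s) hp
  have hpt : p ∈ t.1 := (inf_le_right : s ⊓ t ≤ t) hp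
  refine ⟨s, Set.mem_iUnion_of_mem n hs, coe_nonempty_iff.1 ⟨p, hps⟩, fun q hq => ?_⟩
  refine interior_subset (hball (Metric.mem_ball.2 ?_))
  linarith [dist_triangle q p x, hDT n hs q hq p hps, hdist p hpt]

end RC

theorem IsSigmaDisjointed.preimage {A B : Type*} [BooleanAlgebra A] [BooleanAlgebra B] (e : A ≃o B)
    {S : Set B} (hS : IsSigmaDisjointed S) : IsSigmaDisjointed (e ⁻¹' S) := by
  obtain ⟨C, rfl, hC⟩ := hS
  refine ⟨fun n => e ⁻¹' C n, Set.preimage_iUnion, fun n a ha b hb hab => ?_⟩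
  apply e.injective
  rw [map_inf, map_bot]
  exact hC n _ ha _ hb (e.injective.ne hab)

theorem IsDenseInBooleanAlgebra.preimage {A B : Type*} [BooleanAlgebra A] [BooleanAlgebra B]
    (e : A ≃o B) {S : Set B} (hS : IsDenseInBooleanAlgebra S) :
    IsDenseInBooleanAlgebra (e ⁻¹' S) := by
  intro a ha
  obtain ⟨b, hb, hb0, hba⟩ := hS (e a) ((map_eq_bot_iff e).not.2 ha)
  refine ⟨e.symm b, ?_, (map_eq_bot_iff e.symm).not.2 hb0, e.symm_apply_le.2 hba⟩
  simpa using hb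

/-! ### The space of branches through a sequence of partitions -/

/-- The meet `x 0 ⊓ ⋯ ⊓ x (n - 1)`; it is `⊤` for `n = 0`. -/
def initialMeet {A : Type*} [BooleanAlgebra A] (x : ℕ → A) (n : ℕ) : A :=
  (Finset.range n).inf x

theorem initialMeet_succ {A : Type*} [BooleanAlgebra A] (x : ℕ → A) (n : ℕ) :
    initialMeet x (n + 1) = initialMeet x n ⊓ x n := by
  rw [initialMeet, Finset.range_add_one, Finset.inf_insert, inf_comm, initialMeet]

theorem initialMeet_anti {A : Type*} [BooleanAlgebra A] (x : ℕ → A) : Antitone (initialMeet x) :=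
  fun _ _ h => Finset.inf_mono (Finset.range_mono h)

theorem initialMeet_le {A : Type*} [BooleanAlgebra A] (x : ℕ → A) {i n : ℕ} (h : i < n) :
    initialMeet x n ≤ x i :=
  Finset.inf_le (Finset.mem_range.2 h)

theorem initialMeet_congr {A : Type*} [BooleanAlgebra A] {x y : ℕ → A} {n : ℕ}
    (h : ∀ i < n, y i = x i) : initialMeet y n = initialMeet x n :=
  Finset.inf_congr rfl fun i hi => h i (Finset.mem_range.1 hi)

/-- The sequences that choose an element of each `P n` in such a way that all finite meets are
nonzero: the branches of the tree of nonzero finite meets. -/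
def Branch {A : Type*} [BooleanAlgebra A] (P : ℕ → Set A) : Type _ :=
  {x : ℕ → A // ∀ n, x n ∈ P n ∧ initialMeet x n ≠ ⊥}

namespace Branch

/-- The topology of pointwise convergence, `A` being discrete. -/
instance {A : Type*} [BooleanAlgebra A] (P : ℕ → Set A) : TopologicalSpace (Branch P) :=
  letI : TopologicalSpace A := ⊥
  instTopologicalSpaceSubtype

instance {A : Type*} [BooleanAlgebra A] (P : ℕ → Set A) :
    TopologicalSpace.MetrizableSpace (Branch P) :=
  let : TopologicalSpace A := ⊥
  have : DiscreteTopology A := ⟨rfl⟩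
  have : TopologicalSpace.MetrizableSpace (ℕ → A) :=
    let := PiNat.metricSpace (E := fun _ => A)
    inferInstance
  have h : IsEmbedding (Subtype.val : Branch P → ℕ → A) := .subtypeVal
  h.metrizableSpace

/-- The branches that agree with `x` in the coordinates below `n`. -/
def cylinder {A : Type*} [BooleanAlgebra A] {P : ℕ → Set A} (x : Branch P) (n : ℕ) :
    Set (Branch P) :=
  {y | ∀ i < n, y.1 i = x.1 i}

section BooleanAlgebra

variable {A : Type*} [BooleanAlgebra A] {P : ℕ → Set A}

theorem mem_cylinder_self (x : Branch P) (n : ℕ) : x ∈ cylinder x n := fun _ _ => rfl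

theorem isOpen_cylinder (x : Branch P) (n : ℕ) : IsOpen (cylinder x n) := by
  let : TopologicalSpace A := ⊥
  have : DiscreteTopology A := ⟨rfl⟩
  have h : cylinder x n = Subtype.val ⁻¹' PiNat.cylinder x.1 n := rfl
  rw [h]
  exact (PiNat.isOpen_cylinder (fun _ => A) x.1 n).preimage continuous_subtype_val

theorem exists_cylinder_subset {U : Set (Branch P)} (hU : IsOpen U) {x : Branch P} (hx : x ∈ U) :
    ∃ n, cylinder x n ⊆ U := by
  let : TopologicalSpace A := ⊥
  have : DiscreteTopology A := ⟨rfl⟩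
  obtain ⟨V, hV, rfl⟩ := isOpen_induced_iff.1 hU
  obtain ⟨_, ⟨y, n, rfl⟩, hxy, hyV⟩ :=
    (PiNat.isTopologicalBasis_cylinders (fun _ : ℕ => A)).exists_subset_of_mem_open
      (show x.1 ∈ V from hx) hV
  refine ⟨n, fun z hz => hyV ?_⟩
  rw [← PiNat.mem_cylinder_iff_eq.1 hxy]
  exact hz

theorem mem_closure_iff_cylinder {S : Set (Branch P)} {x : Branch P} :
    x ∈ closure S ↔ ∀ n, ∃ y ∈ S, y ∈ cylinder x n := by
  rw [mem_closure_iff]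
  constructor
  · intro h n
    obtain ⟨y, hy, hyS⟩ := h _ (isOpen_cylinder x n) (mem_cylinder_self x n)
    exact ⟨y, hyS, hy⟩
  · intro h U hU hx
    obtain ⟨n, hn⟩ := exists_cylinder_subset hU hx
    obtain ⟨y, hyS, hy⟩ := h n
    exact ⟨y, hn hy, hyS⟩

theorem initialMeet_ne_bot (x : Branch P) (n : ℕ) : initialMeet x.1 n ≠ ⊥ := (x.2 n).2

/-- For disjoint families, the order of finite meets reflects inclusion of cylinders. -/
theorem mem_cylinder_of_initialMeet_le (hP : ∀ n, (P n).PairwiseDisjoint id) {x y : Branch P}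
    {k n : ℕ} (h : initialMeet y.1 k ≤ initialMeet x.1 n) : y ∈ cylinder x n := by
  intro i hi
  by_contra hne
  refine y.initialMeet_ne_bot (max k n) (le_bot_iff.1 ?_)
  refine le_trans ?_ (hP i (y.2 i).1 (x.2 i).1 hne).le_bot
  exact le_inf (initialMeet_le y.1 (hi.trans_le (le_max_right _ _)))
    ((initialMeet_anti y.1 (le_max_left _ _)).trans (h.trans (initialMeet_le x.1 hi)))

/-- The branches that have a finite meet below `a`. -/
def openSet (P : ℕ → Set A) (a : A) : Set (Branch P) :=
  {x | ∃ n, initialMeet x.1 n ≤ a}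

/-- The branches all of whose finite meets meet `a`. -/
def closedSet (P : ℕ → Set A) (a : A) : Set (Branch P) :=
  {x | ∀ n, initialMeet x.1 n ⊓ a ≠ ⊥}

theorem isOpen_openSet (a : A) : IsOpen (openSet P a) := by
  refine isOpen_iff_forall_mem_open.2 fun x ⟨n, hn⟩ =>
    ⟨cylinder x n, fun y hy => ⟨n, ?_⟩, isOpen_cylinder x n, mem_cylinder_self x n⟩
  rwa [initialMeet_congr hy]

theorem openSet_subset_closedSet (a : A) : openSet P a ⊆ closedSet P a := by
  rintro x ⟨n, hn⟩ k h
  refine x.initialMeet_ne_bot (max k n) (le_bot_iff.1 (le_trans ?_ h.le))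
  exact le_inf (initialMeet_anti x.1 (le_max_left _ _))
    ((initialMeet_anti x.1 (le_max_right _ _)).trans hn)

end BooleanAlgebra

section CompleteBooleanAlgebra

variable {A : Type*} [CompleteBooleanAlgebra A] {P : ℕ → Set A}

/-- Finite meets of branches are dense in `A`. Given `b ∈ P n` with `⊥ ≠ b ≤ c`, choose a branch
whose finite meets all meet `b`; by disjointness its `n`-th entry has to be `b`. -/
theorem exists_initialMeet_le (hP : ∀ n, (P n).PairwiseDisjoint id) (hsup : ∀ n, sSup (P n) = ⊤)
    (hdense : IsDenseInBooleanAlgebra (⋃ n, P n)) {c : A} (hc : c ≠ ⊥) :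
    ∃ (x : Branch P) (n : ℕ), initialMeet x.1 n ≤ c := by
  obtain ⟨b, hb, hb0, hbc⟩ := hdense c hc
  obtain ⟨n, hn⟩ := Set.mem_iUnion.1 hb
  have step : ∀ (k : ℕ) (d : A), d ≠ ⊥ → ∃ p ∈ P k, d ⊓ p ≠ ⊥ := by
    intro k d hd
    by_contra! h
    apply hd
    rw [← inf_top_eq d, ← hsup k, inf_sSup_eq]
    simpa using h
  choose! f hfP hf using step
  let d : ℕ → A := Nat.rec b fun k e => e ⊓ f k e
  let x : ℕ → A := fun k => f k (d k)
  have hd : ∀ k, d k ≠ ⊥ := fun k => Nat.rec hb0 (fun j hj => hf j (d j) hj) k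
  have hdx : ∀ k, d k = b ⊓ initialMeet x k := by
    intro k
    induction k with
    | zero => simp [d, initialMeet]
    | succ k ih => rw [initialMeet_succ, ← inf_assoc, ← ih]
  have hxb : ∀ k, b ⊓ initialMeet x k ≠ ⊥ := fun k => hdx k ▸ hd k
  refine ⟨⟨x, fun k => ⟨hfP k _ (hd k), fun h => hxb k (by rw [h, inf_bot_eq])⟩⟩, n + 1, ?_⟩
  have hxn : x n = b := by
    by_contra hne
    refine hxb (n + 1) (le_bot_iff.1 ?_)
    rw [← (hP n (hfP n _ (hd n)) hn hne).eq_bot]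
    exact le_inf (inf_le_right.trans (initialMeet_le x n.lt_succ_self)) inf_le_left
  exact (initialMeet_le x n.lt_succ_self).trans (hxn.le.trans hbc)

theorem closure_openSet (hP : ∀ n, (P n).PairwiseDisjoint id) (hsup : ∀ n, sSup (P n) = ⊤)
    (hdense : IsDenseInBooleanAlgebra (⋃ n, P n)) (a : A) :
    closure (openSet P a) = closedSet P a := by
  ext x
  rw [mem_closure_iff_cylinder]
  constructor
  · intro h n
    obtain ⟨y, hy, hyx⟩ := h n
    rw [← initialMeet_congr hyx]
    exact openSet_subset_closedSet a hy n
  · intro h n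
    obtain ⟨y, k, hy⟩ := exists_initialMeet_le hP hsup hdense (h n)
    exact ⟨y, ⟨k, hy.trans inf_le_right⟩,
      mem_cylinder_of_initialMeet_le hP (hy.trans inf_le_left)⟩

/-- If the `P n` are partitions of unity with dense union, every regular closed set `F` of branches
is of the form `closedSet P a`, where `a` is the supremum of the finite meets whose cylinder lies
in `F`. -/
theorem exists_closedSet_eq (hP : ∀ n, (P n).PairwiseDisjoint id) (hsup : ∀ n, sSup (P n) = ⊤)
    (hdense : IsDenseInBooleanAlgebra (⋃ n, P n)) (F : RC (Branch P)) :
    ∃ a, closedSet P a = F.1 := by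
  let T : Set A := {c | ∃ (y : Branch P) (k : ℕ), cylinder y k ⊆ F.1 ∧ initialMeet y.1 k = c}
  refine ⟨sSup T, ?_⟩
  rw [← closure_openSet hP hsup hdense]
  apply Set.Subset.antisymm
  · refine closure_minimal ?_ F.isClosed
    rintro x ⟨n, hn⟩
    rw [← F.isClosed.closure_eq, mem_closure_iff_cylinder]
    intro k
    obtain ⟨c, ⟨y, j, hyF, rfl⟩, hc⟩ : ∃ c ∈ T, initialMeet x.1 (max k n) ⊓ c ≠ ⊥ := by
      by_contra! h
      apply x.initialMeet_ne_bot (max k n)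
      rw [← inf_eq_left.2 ((initialMeet_anti x.1 (le_max_right k n)).trans hn), inf_sSup_eq]
      simpa using h
    obtain ⟨z, l, hz⟩ := exists_initialMeet_le hP hsup hdense hc
    exact ⟨z, hyF (mem_cylinder_of_initialMeet_le hP (hz.trans inf_le_right)),
      mem_cylinder_of_initialMeet_le hP
        ((hz.trans inf_le_left).trans (initialMeet_anti x.1 (le_max_left k n)))⟩
  · rw [F.2]
    refine closure_mono fun x hx => ?_
    obtain ⟨k, hk⟩ := exists_cylinder_subset isOpen_interior hx
    exact ⟨k, le_sSup ⟨x, k, hk.trans interior_subset, rfl⟩⟩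

theorem closedSet_subset_closedSet_iff (hP : ∀ n, (P n).PairwiseDisjoint id)
    (hsup : ∀ n, sSup (P n) = ⊤) (hdense : IsDenseInBooleanAlgebra (⋃ n, P n)) {a b : A} :
    closedSet P a ⊆ closedSet P b ↔ a ≤ b := by
  refine ⟨fun h => ?_, fun h x hx n hn => hx n (le_bot_iff.1 ((inf_le_inf_left _ h).trans hn.le))⟩
  by_contra hab
  obtain ⟨x, n, hx⟩ := exists_initialMeet_le hP hsup hdense (mt sdiff_eq_bot_iff.1 hab)
  refine h (openSet_subset_closedSet a ⟨n, hx.trans sdiff_le⟩) n (le_bot_iff.1 ?_)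
  exact (inf_le_inf_right b hx).trans (by simp)

/-- A complete Boolean algebra is the algebra of regular closed sets of the space of branches
through any sequence of partitions of unity with dense union. -/
noncomputable def orderIso (hP : ∀ n, (P n).PairwiseDisjoint id) (hsup : ∀ n, sSup (P n) = ⊤)
    (hdense : IsDenseInBooleanAlgebra (⋃ n, P n)) : A ≃o RC (Branch P) :=
  RelIso.ofSurjective
    (OrderEmbedding.ofMapLEIff
      (fun a => (⟨closedSet P a, by
        rw [← closure_openSet hP hsup hdense]
        exact RC.closure_open_regular (isOpen_openSet a)⟩ : RC (Branch P)))
      fun _ _ => closedSet_subset_closedSet_iff hP hsup hdense)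
    fun F => (exists_closedSet_eq hP hsup hdense F).imp fun _ h => Subtype.ext h

end CompleteBooleanAlgebra

end Branch

/-! ### The characterization -/

theorem corollary4p6 {A : Type u} [CompleteBooleanAlgebra A] :
    (∃ (X : Type u) (_ : TopologicalSpace X),
        TopologicalSpace.MetrizableSpace X ∧ Nonempty (A ≃o RC X)) ↔
      ∃ B : Set A, IsSigmaDisjointed B ∧ IsDenseInBooleanAlgebra B := by
  constructor
  · rintro ⟨X, _, _, ⟨e⟩⟩
    obtain ⟨B, hσ, hdense⟩ := RC.exists_isSigmaDisjointed_isDense (X := X)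
    exact ⟨e ⁻¹' B, hσ.preimage e, hdense.preimage e⟩
  · rintro ⟨_, ⟨C, rfl, hC⟩, hdense⟩
    let P : ℕ → Set A := fun n => insert (sSup (C n))ᶜ (C n)
    have hP : ∀ n, (P n).PairwiseDisjoint id := fun n =>
      Set.PairwiseDisjoint.insert (fun a ha b hb hab => disjoint_iff.2 (hC n a ha b hb hab))
        fun b hb _ => (disjoint_compl_left (a := sSup (C n))).mono_right (le_sSup hb)
    have hsup : ∀ n, sSup (P n) = ⊤ := fun n => by
      simp only [P, sSup_insert, compl_sup_eq_top]
    have hPdense : IsDenseInBooleanAlgebra (⋃ n, P n) := fun a ha =>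
      (hdense a ha).imp fun b hb =>
        ⟨Set.iUnion_mono (fun n => Set.subset_insert _ _) hb.1, hb.2⟩
    exact ⟨Branch P, inferInstance, inferInstance, ⟨Branch.orderIso hP hsup hPdense⟩⟩
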